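/- **Proposition 4.2.** Let $(\overline M,\overline\phi,\xi,\eta,\overline g)$ be an indefinite almost contact metric manifold of dimension $n+3$: $\overline g$ is semi-Riemannian, $\overline\phi^2=-I+\eta\otimes\xi$, $\eta(\xi)=1$, $\eta\circ\overline\phi=0$, $\overline\phi\,\xi=0$ and $\overline g(\overline\phi X,\overline\phi Y)=\overline g(X,Y)-\eta(X)\eta(Y)$. Let $\overline\nabla$ be a semi-symmetric non-metric connection on it, i.e. $$(\overline\nabla_X\overline g)(Y,Z)=-\eta(Y)\overline g(X,Z)-\eta(Z)\overline g(X,Y),\qquad \overline T(X,Y)=\eta(Y)X-\eta(X)Y .$$ Let $M$ be an $(n+1)$-dimensional half-lightlike submanifold of $\overline M$ (codimension two, $\mathrm{Rad}\,TM=TM\cap TM^\perp$ of rank one, and $TM^\perp$ not totally null) with a screen distribution $S(TM)$, $TM=\mathrm{Rad}\,TM\perp S(TM)$. Over an open set $U\subset M$ let $E$ be a nowhere zero section of $\mathrm{Rad}\,TM$, $W$ a section of $TM^\perp$ with $\overline g(W,W)=\pm1$, and $N$ the null section of $T\overline M|_M$ orthogonal to $S(TM)$ and $W$ with $\overline g(E,N)=1$.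 Put $\lambda(X)=\overline g(X,N)$ and let $P:TM\to S(TM)$ be the projection along $\mathrm{Rad}\,TM$. For $X,Y\in\Gamma(TM)$ define the induced connection $\nabla$, the forms $B,C$ and the shape operators $A_N,A_E^*$ by $$\overline\nabla_XY=\nabla_XY+B(X,Y)N+D(X,Y)W,\qquad \overline\nabla_XN=-A_NX+\tau(X)N+\rho(X)W,$$ $$\nabla_XPY=\nabla^*_XPY+C(X,PY)E,\qquad \nabla_XE=-A_E^*X-\delta(X)E,$$ where $\nabla_XY$ and $A_NX$ are tangent to $M$, and $\nabla^*_XPY$ and $A_E^*X$ lie in $S(TM)$. Assume that $M$ is screen almost conformal (SAC) over $U$: $\xi$ is tangent to $M$ and, for a nowhere vanishing smooth function $\varphi$ on $U$, $$C(X,PY)=\varphi\,B(X,Y)+\lambda(X)\,\eta(PY)\qquad\text{for all }X,Y\in\Gamma(TM).$$ Let $a=\eta(N)$. For each point of $U$ let $\kappa_0^*,\dots,\kappa_n^*$ be the principal curvatures of $A_E^*$, i.e. its eigenvalues counted with algebraic multiplicity (in $\mathbb R$ if they are all real, otherwise in $\mathbb C$), and let the $r$-th mean curvatures $S_r$ of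 $A_N$ and $S_r^*$ of $A_E^*$ be the $r$-th elementary symmetric functions of the $n+1$ eigenvalues of $A_N$ and of $A_E^*$, respectively. Then, for all $r\ge1$, at every point of $U$, $$S_r=\varphi^rS_r^*+J_r^*(a,\varphi),$$ where, for given $A_E^*$, $J_r^*$ is the smooth function of $a$ and $\varphi$ given by $$J_r^*(a,\varphi)=\sum_{0\le i_1<\cdots<i_r\le n}(-1)^ra^r+\sum_{0\le i_1<\cdots<i_r\le n}\ \sum_{j=1}^{r-1}(-1)^{r+j}e_j(\kappa_{i_1}^*,\dots,\kappa_{i_r}^*)\,a^{r-j}\varphi^j,$$ and $e_j$ denotes the $j$-th elementary symmetric polynomial. -/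

import Mathlib

open Bundle Manifold
open scoped ContDiff Topology

noncomputable section

namespace LightlikeGeometry

instance finite_tangentSpace {d : ℕ} {Mbar : Type*} [TopologicalSpace Mbar]
    [ChartedSpace (EuclideanSpace ℝ (Fin d)) Mbar] (x : Mbar) :
    Module.Finite ℝ (TangentSpace (𝓡 d) x) :=
  inferInstanceAs (Module.Finite ℝ (EuclideanSpace ℝ (Fin d)))

section Ambient

variable (d : ℕ) (Mbar : Type*) [TopologicalSpace Mbar] [ChartedSpace (EuclideanSpace ℝ (Fin d)) Mbar]
  [IsManifold (𝓡 d) ∞ Mbar]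

/-- A semi-Riemannian metric on a smooth manifold: a smooth, symmetric, nondegenerate
`(0,2)`-tensor field of constant index `ν` (the index at `x` is the largest dimension of a
negative definite subspace of the tangent space at `x`). -/
structure SemiRiemannianMetric where
  val : ∀ x : Mbar, TangentSpace (𝓡 d) x →L[ℝ] TangentSpace (𝓡 d) x →L[ℝ] ℝ
  symm : ∀ x v w, val x v w = val x w v
  nondegenerate : ∀ x v, (∀ w, val x v w = 0) → v = 0
  constant_index : ∃ ν : ℕ, ∀ x : Mbar, IsGreatest
    {k : ℕ | ∃ V : Submodule ℝ (TangentSpace (𝓡 d) x),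
      Module.finrank ℝ V = k ∧ ∀ v ∈ V, v ≠ 0 → val x v v < 0} ν
  contMDiff : ContMDiff (𝓡 d)
    ((𝓡 d).prod 𝓘(ℝ, EuclideanSpace ℝ (Fin d) →L[ℝ] EuclideanSpace ℝ (Fin d) →L[ℝ] ℝ)) ∞
    (fun x ↦ TotalSpace.mk' (EuclideanSpace ℝ (Fin d) →L[ℝ] EuclideanSpace ℝ (Fin d) →L[ℝ] ℝ)
      (E := fun x : Mbar ↦ TangentSpace (𝓡 d) x →L[ℝ] TangentSpace (𝓡 d) x →L[ℝ] ℝ) x (val x))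

/-- An indefinite almost contact metric structure `(φ̄, ξ, η, ḡ)`:
`φ̄² = -I + η ⊗ ξ`, `η(ξ) = 1`, `η ∘ φ̄ = 0`, `φ̄ ξ = 0`,
`ḡ(φ̄ X, φ̄ Y) = ḡ(X, Y) - η(X) η(Y)`. -/
structure AlmostContactMetricStructure where
  g : SemiRiemannianMetric d Mbar
  phi : ∀ x : Mbar, TangentSpace (𝓡 d) x →L[ℝ] TangentSpace (𝓡 d) x
  xi : ∀ x : Mbar, TangentSpace (𝓡 d) x
  eta : ∀ x : Mbar, TangentSpace (𝓡 d) x →L[ℝ] ℝ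
  contMDiff_phi : ContMDiff (𝓡 d)
    ((𝓡 d).prod 𝓘(ℝ, EuclideanSpace ℝ (Fin d) →L[ℝ] EuclideanSpace ℝ (Fin d))) ∞
    (fun x ↦ TotalSpace.mk' (EuclideanSpace ℝ (Fin d) →L[ℝ] EuclideanSpace ℝ (Fin d))
      (E := fun x : Mbar ↦ TangentSpace (𝓡 d) x →L[ℝ] TangentSpace (𝓡 d) x) x (phi x))
  contMDiff_xi : ContMDiff (𝓡 d) (𝓡 d).tangent ∞
    (fun x ↦ (⟨x, xi x⟩ : TangentBundle (𝓡 d) Mbar))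
  contMDiff_eta : ContMDiff (𝓡 d)
    ((𝓡 d).prod 𝓘(ℝ, EuclideanSpace ℝ (Fin d) →L[ℝ] ℝ)) ∞
    (fun x ↦ TotalSpace.mk' (EuclideanSpace ℝ (Fin d) →L[ℝ] ℝ)
      (E := fun x : Mbar ↦ TangentSpace (𝓡 d) x →L[ℝ] ℝ) x (eta x))
  phi_phi : ∀ x v, phi x (phi x v) = -v + eta x v • xi x
  eta_xi : ∀ x, eta x (xi x) = 1
  eta_phi : ∀ x v, eta x (phi x v) = 0
  phi_xi : ∀ x, phi x (xi x) = 0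
  g_phi_phi : ∀ x v w, g.val x (phi x v) (phi x w) = g.val x v w - eta x v * eta x w

variable {d Mbar}

/-- A linear connection `∇̄` (in Mathlib's convention `nabla Y x v` is `∇̄_v Y` at `x`) is a
semi-symmetric non-metric connection for the 1-form `η` and the metric `ḡ`:
`(∇̄_X ḡ)(Y, Z) = -η(Y) ḡ(X, Z) - η(Z) ḡ(X, Y)` and `T̄(X, Y) = η(Y) X - η(X) Y`. -/
structure IsSemiSymmetricNonMetric (s : AlmostContactMetricStructure d Mbar)
    (nabla : CovariantDerivative (𝓡 d) (EuclideanSpace ℝ (Fin d))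
      (TangentSpace (𝓡 d) : Mbar → Type _)) : Prop where
  deriv_metric : ∀ (x : Mbar) (v : TangentSpace (𝓡 d) x) (Y Z : ∀ y : Mbar, TangentSpace (𝓡 d) y),
    MDifferentiableAt (𝓡 d) (𝓡 d).tangent (fun y ↦ (⟨y, Y y⟩ : TangentBundle (𝓡 d) Mbar)) x →
    MDifferentiableAt (𝓡 d) (𝓡 d).tangent (fun y ↦ (⟨y, Z y⟩ : TangentBundle (𝓡 d) Mbar)) x →
    mvfderiv (𝓡 d) (fun y ↦ s.g.val y (Y y) (Z y)) x v
        - s.g.val x (nabla Y x v) (Z x) - s.g.val x (Y x) (nabla Z x v)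
      = -(s.eta x (Y x) * s.g.val x v (Z x)) - s.eta x (Z x) * s.g.val x v (Y x)
  torsion : ∀ (x : Mbar) (v w : TangentSpace (𝓡 d) x),
    nabla.torsion x v w = s.eta x w • v - s.eta x v • w

end Ambient

section AlongMap

variable {m d : ℕ} {M : Type*} [TopologicalSpace M] [ChartedSpace (EuclideanSpace ℝ (Fin m)) M]
  {Mbar : Type*} [TopologicalSpace Mbar] [ChartedSpace (EuclideanSpace ℝ (Fin d)) Mbar]
  [IsManifold (𝓡 d) ∞ Mbar]

/-- The covariant derivative `v ↦ ∇̄_v V` at `p` of a vector field `V` along `f : M → Mbar`, i.e. the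
pull-back along `f` of the connection `∇̄` of `Mbar`. With `eᵢ` the local frame of `T Mbar` given by the
trivialization at `f p`, and `V q = ∑ Vⁱ(q) eᵢ(f q)`, it is
`∇̄_v V = ∑ dVⁱ(v) eᵢ(f p) + ∑ Vⁱ(p) ∇̄_{df v} eᵢ`. -/
def covDerivAlong
    (nabla : CovariantDerivative (𝓡 d) (EuclideanSpace ℝ (Fin d))
      (TangentSpace (𝓡 d) : Mbar → Type _))
    (f : M → Mbar) (V : ∀ q : M, TangentSpace (𝓡 d) (f q)) (p : M) :
    TangentSpace (𝓡 m) p →L[ℝ] TangentSpace (𝓡 d) (f p) :=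
  let e := trivializationAt (EuclideanSpace ℝ (Fin d)) (TangentSpace (𝓡 d) : Mbar → Type _) (f p)
  let coord : M → EuclideanSpace ℝ (Fin d) := fun q ↦ (e ⟨f q, V q⟩).2
  e.symmL ℝ (f p) ∘L mvfderiv (𝓡 m) coord p
    + nabla (fun y ↦ e.symm y (coord p)) (f p) ∘L mfderiv (𝓡 m) (𝓡 d) f p

variable (g : SemiRiemannianMetric d Mbar) (f : M → Mbar)

/-- `T_p M^⊥`, the `ḡ`-orthogonal complement of `df(T_p M)` in the ambient tangent space. -/
def normalSpace (p : M) : Submodule ℝ (TangentSpace (𝓡 d) (f p)) where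
  carrier := {v | ∀ X : TangentSpace (𝓡 m) p, g.val (f p) (mfderiv (𝓡 m) (𝓡 d) f p X) v = 0}
  zero_mem' := fun X ↦ by simp
  add_mem' := fun {v w} hv hw X ↦ by
    rw [map_add, hv X, hw X, add_zero]
  smul_mem' := fun c v hv X ↦ by
    rw [map_smul, hv X, smul_zero]

/-- `Rad T_p M = T_p M ∩ T_p M^⊥`, as a subspace of `T_p M`. -/
def radical (p : M) : Submodule ℝ (TangentSpace (𝓡 m) p) :=
  (normalSpace (m := m) g f p).comap (mfderiv (𝓡 m) (𝓡 d) f p).toLinearMap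

end AlongMap

section HalfLightlike

variable {n : ℕ} {M : Type*} [TopologicalSpace M]
  [ChartedSpace (EuclideanSpace ℝ (Fin (n + 1))) M] [IsManifold (𝓡 (n + 1)) ∞ M]
  {Mbar : Type*} [TopologicalSpace Mbar] [ChartedSpace (EuclideanSpace ℝ (Fin (n + 3))) Mbar]
  [IsManifold (𝓡 (n + 3)) ∞ Mbar]

/-- `f : M → Mbar` is a half-lightlike submanifold: an immersed submanifold of codimension two whose
radical distribution has rank one, and such that at each point `TM^⊥` contains a nonzero `E`
orthogonal to `TM^⊥` and a non-null `W`. -/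
structure IsHalfLightlike (g : SemiRiemannianMetric (n + 3) Mbar) (f : M → Mbar) : Prop where
  isImmersion : IsImmersion (𝓡 (n + 1)) (𝓡 (n + 3)) ∞ f
  finrank_radical : ∀ p, Module.finrank ℝ (radical (m := n + 1) g f p) = 1
  exists_normal : ∀ p, ∃ E ∈ normalSpace (m := n + 1) g f p,
    ∃ W ∈ normalSpace (m := n + 1) g f p,
      E ≠ 0 ∧ (∀ V ∈ normalSpace (m := n + 1) g f p, g.val (f p) E V = 0) ∧ g.val (f p) W W ≠ 0

/-- `S` is a screen distribution `S(TM)`: a smooth distribution on `M` complementary to `Rad TM`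
in `TM` (the orthogonality to `Rad TM` and the nondegeneracy of `g` on `S` are then automatic). -/
structure IsScreenDistribution (g : SemiRiemannianMetric (n + 3) Mbar) (f : M → Mbar)
    (S : ∀ p : M, Submodule ℝ (TangentSpace (𝓡 (n + 1)) p)) : Prop where
  isCompl : ∀ p, IsCompl (radical (m := n + 1) g f p) (S p)
  smooth : ∀ p, ∃ Z : Fin n → ∀ q : M, TangentSpace (𝓡 (n + 1)) q,
    (∀ i, ContMDiffAt (𝓡 (n + 1)) (𝓡 (n + 1)).tangent ∞
      (fun q ↦ (⟨q, Z i q⟩ : TangentBundle (𝓡 (n + 1)) M)) p) ∧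
    ∀ᶠ q in 𝓝 p, S q = Submodule.span ℝ (Set.range fun i ↦ Z i q)

/-- The local sections `E` of `Rad TM`, `W` of the screen transversal bundle `S(TM^⊥)` and `N` of
the lightlike transversal bundle `ltr(TM)` over an open set `U` of the half-lightlike submanifold
with screen distribution `S`: `E` spans `Rad TM`; `W` is a unit (spacelike or timelike) section of
`TM^⊥`, spanning a complement `S(TM^⊥)` of `Rad TM` in `TM^⊥`; `N` is the null section orthogonal
to `S(TM)` and `S(TM^⊥)` with `ḡ(E, N) = 1`. -/
structure LightlikeFrame (g : SemiRiemannianMetric (n + 3) Mbar) (f : M → Mbar)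
    (S : ∀ p : M, Submodule ℝ (TangentSpace (𝓡 (n + 1)) p)) (U : Set M) where
  E : ∀ p : M, TangentSpace (𝓡 (n + 1)) p
  W : ∀ p : M, TangentSpace (𝓡 (n + 3)) (f p)
  N : ∀ p : M, TangentSpace (𝓡 (n + 3)) (f p)
  contMDiffOn_E : ContMDiffOn (𝓡 (n + 1)) (𝓡 (n + 1)).tangent ∞
    (fun p ↦ (⟨p, E p⟩ : TangentBundle (𝓡 (n + 1)) M)) U
  contMDiffOn_W : ContMDiffOn (𝓡 (n + 1)) (𝓡 (n + 3)).tangent ∞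
    (fun p ↦ (⟨f p, W p⟩ : TangentBundle (𝓡 (n + 3)) _)) U
  contMDiffOn_N : ContMDiffOn (𝓡 (n + 1)) (𝓡 (n + 3)).tangent ∞
    (fun p ↦ (⟨f p, N p⟩ : TangentBundle (𝓡 (n + 3)) _)) U
  E_ne_zero : ∀ p ∈ U, E p ≠ 0
  E_mem : ∀ p ∈ U, E p ∈ radical (m := n + 1) g f p
  W_mem : ∀ p ∈ U, W p ∈ normalSpace (m := n + 1) g f p
  W_unit : ∀ p ∈ U, g.val (f p) (W p) (W p) = 1 ∨ g.val (f p) (W p) (W p) = -1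
  N_null : ∀ p ∈ U, g.val (f p) (N p) (N p) = 0
  N_screen : ∀ p ∈ U, ∀ Z ∈ S p,
    g.val (f p) (mfderiv (𝓡 (n + 1)) (𝓡 (n + 3)) f p Z) (N p) = 0
  N_W : ∀ p ∈ U, g.val (f p) (N p) (W p) = 0
  E_N : ∀ p ∈ U, g.val (f p) (mfderiv (𝓡 (n + 1)) (𝓡 (n + 3)) f p (E p)) (N p) = 1

namespace LightlikeFrame

variable {g : SemiRiemannianMetric (n + 3) Mbar} {f : M → Mbar}
  {S : ∀ p : M, Submodule ℝ (TangentSpace (𝓡 (n + 1)) p)} {U : Set M}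
  (F : LightlikeFrame g f S U)
  (nabla : CovariantDerivative (𝓡 (n + 3)) (EuclideanSpace ℝ (Fin (n + 3)))
    (TangentSpace (𝓡 (n + 3)) : Mbar → Type _))

/-- The decomposition `T Mbar|_M = TM ⊕ ltr(TM) ⊕ S(TM^⊥)`: it sends `df X + b N + c W` to
`(X, b, c)`. For `p ∈ U` the map `(X, b, c) ↦ df X + b N + c W` is bijective, and this is its
inverse. -/
def decomp (p : M) :
    TangentSpace (𝓡 (n + 3)) (f p) →L[ℝ] TangentSpace (𝓡 (n + 1)) p × ℝ × ℝ :=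
  ContinuousLinearMap.inverse
    ((mfderiv (𝓡 (n + 1)) (𝓡 (n + 3)) f p).coprod
      ((ContinuousLinearMap.toSpanSingleton ℝ (F.N p)).coprod
        (ContinuousLinearMap.toSpanSingleton ℝ (F.W p))))

/-- The 1-form `λ(X) = ḡ(X, N)` on `TM`. -/
def lam (p : M) : TangentSpace (𝓡 (n + 1)) p →L[ℝ] ℝ :=
  g.val (f p) (F.N p) ∘L mfderiv (𝓡 (n + 1)) (𝓡 (n + 3)) f p

/-- The projection `P` of `TM` onto `S(TM)` along `Rad TM`. As `λ` vanishes on `S(TM)` and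
`λ(E) = 1`, it is `P X = X - λ(X) E`. -/
def screenProj (p : M) : TangentSpace (𝓡 (n + 1)) p →L[ℝ] TangentSpace (𝓡 (n + 1)) p :=
  ContinuousLinearMap.id ℝ _ - (F.lam p).smulRight (F.E p)

/-- The covariant derivative `∇̄_X Y`, for `Y` a vector field on `M`. -/
def ambientDeriv (Y : ∀ q : M, TangentSpace (𝓡 (n + 1)) q) (p : M) :
    TangentSpace (𝓡 (n + 1)) p →L[ℝ] TangentSpace (𝓡 (n + 3)) (f p) :=
  covDerivAlong nabla f (fun q ↦ mfderiv (𝓡 (n + 1)) (𝓡 (n + 3)) f q (Y q)) p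

/-- The induced connection `∇` on `M`: `∇̄_X Y = ∇_X Y + B(X, Y) N + D(X, Y) W`. -/
def inducedConnection (Y : ∀ q : M, TangentSpace (𝓡 (n + 1)) q) (p : M) :
    TangentSpace (𝓡 (n + 1)) p →L[ℝ] TangentSpace (𝓡 (n + 1)) p :=
  ContinuousLinearMap.fst ℝ _ _ ∘L F.decomp p ∘L ambientDeriv (f := f) nabla Y p

/-- The local second fundamental form `B`: `∇̄_X Y = ∇_X Y + B(X, Y) N + D(X, Y) W`. -/
def formB (p : M) (X : TangentSpace (𝓡 (n + 1)) p)
    (Y : ∀ q : M, TangentSpace (𝓡 (n + 1)) q) : ℝ :=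
  (F.decomp p (ambientDeriv (f := f) nabla Y p X)).2.1

/-- The local second fundamental form `C` of the screen: `∇_X PY = ∇*_X PY + C(X, PY) E` with
`∇*_X PY` in `S(TM)`. The component along `E` in `TM = S(TM) ⊕ Rad TM` is read off by `λ`. -/
def formC (p : M) (X : TangentSpace (𝓡 (n + 1)) p)
    (Y : ∀ q : M, TangentSpace (𝓡 (n + 1)) q) : ℝ :=
  F.lam p (F.inducedConnection nabla (fun q ↦ F.screenProj q (Y q)) p X)

/-- The shape operator `A_N` of `M`: `∇̄_X N = -A_N X + τ(X) N + ρ(X) W`. -/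
def shapeN (p : M) : TangentSpace (𝓡 (n + 1)) p →L[ℝ] TangentSpace (𝓡 (n + 1)) p :=
  -(ContinuousLinearMap.fst ℝ _ _ ∘L F.decomp p ∘L covDerivAlong nabla f F.N p)

/-- The shape operator `A*_E` of the screen: `∇_X E = -A*_E X - δ(X) E` with `A*_E X` in
`S(TM)`. -/
def shapeE (p : M) : TangentSpace (𝓡 (n + 1)) p →L[ℝ] TangentSpace (𝓡 (n + 1)) p :=
  -(F.screenProj p ∘L F.inducedConnection nabla F.E p)

/-- `M` is screen almost conformal over `U`, with conformal factor `φ` (a nowhere vanishing smooth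
function on `U`): the structure field `ξ` is tangent to `M`, and
`C(X, PY) = φ B(X, Y) + λ(X) η(PY)` for all `X, Y` tangent to `M`. -/
structure IsSAC (s : AlmostContactMetricStructure (n + 3) Mbar)
    {f : M → Mbar} {S : ∀ p : M, Submodule ℝ (TangentSpace (𝓡 (n + 1)) p)} {U : Set M}
    (F : LightlikeFrame s.g f S U)
    (nabla : CovariantDerivative (𝓡 (n + 3)) (EuclideanSpace ℝ (Fin (n + 3)))
      (TangentSpace (𝓡 (n + 3)) : Mbar → Type _))
    (phi : M → ℝ) : Prop where
  xi_tangent : ∀ p, ∃ X : TangentSpace (𝓡 (n + 1)) p,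
    mfderiv (𝓡 (n + 1)) (𝓡 (n + 3)) f p X = s.xi (f p)
  contMDiffOn : ContMDiffOn (𝓡 (n + 1)) 𝓘(ℝ, ℝ) ∞ phi U
  ne_zero : ∀ p ∈ U, phi p ≠ 0
  conformal : ∀ p ∈ U, ∀ (X : TangentSpace (𝓡 (n + 1)) p)
    (Y : ∀ q : M, TangentSpace (𝓡 (n + 1)) q),
    ContMDiffAt (𝓡 (n + 1)) (𝓡 (n + 1)).tangent ∞
      (fun q ↦ (⟨q, Y q⟩ : TangentBundle (𝓡 (n + 1)) M)) p →
    F.formC nabla p X Y = phi p * F.formB nabla p X Y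
      + F.lam p X * s.eta (f p) (mfderiv (𝓡 (n + 1)) (𝓡 (n + 3)) f p (F.screenProj p (Y p)))

end LightlikeFrame

end HalfLightlike

section MeanCurvature

variable (K : Type*) [RCLike K] {V : Type*} [AddCommGroup V] [Module ℝ V]
  [Module.Finite ℝ V] [Module.Free ℝ V]

/-- The principal curvatures of a real operator `A`: its eigenvalues in `K` (`ℝ` or `ℂ`), as the
roots of its characteristic polynomial, with multiplicity. -/
def principalCurvatures (A : V →ₗ[ℝ] V) : Multiset K :=
  (A.charpoly.map (algebraMap ℝ K)).roots

/-- The `r`-th mean curvature `S_r = σ_r(κ₀, …, κ_n)`, the `r`-th elementary symmetric function of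
the principal curvatures. -/
def meanCurvature (A : V →ₗ[ℝ] V) (r : ℕ) : K :=
  (principalCurvatures K A).esymm r

variable {K} {n : ℕ}

/-- `J*_r(a, φ) = ∑_{0 ≤ i₁ < ⋯ < i_r ≤ n} (-1)^r a^r
  + ∑_{0 ≤ i₁ < ⋯ < i_r ≤ n} ∑_{j=1}^{r-1} (-1)^{r+j} e_j(κ_{i₁}, …, κ_{i_r}) a^{r-j} φ^j`. -/
def J (kappa : Fin (n + 1) → K) (r : ℕ) (a phi : ℝ) : K :=
  ∑ _I ∈ Finset.powersetCard r (Finset.univ : Finset (Fin (n + 1))), (-1 : K) ^ r * (a : K) ^ r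
    + ∑ I ∈ Finset.powersetCard r (Finset.univ : Finset (Fin (n + 1))),
        ∑ j ∈ Finset.Ico 1 r, (-1 : K) ^ (r + j) * (I.val.map kappa).esymm j
          * (a : K) ^ (r - j) * (phi : K) ^ j

end MeanCurvature

end LightlikeGeometry

end

namespace LightlikeGeometry

/-! The heart is the pointwise operator identity `A_N = φ A*_E - a I` on `T_pM`, with `a = η(N)`
(`IsSAC.shapeN_eq`). The eigenvalues of `A_N` are then `φ κᵢ - a`, and expanding each product over
an `r`-subset in powers of `a` and `φ` gives the formula: degree `r` in `φ` is `φ^r S*_r`, all lower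
degrees make up `J`.

The identity comes from differentiating three constant pairings along `X` with the non-metric
connection (`mvfderiv_metric_along`). From `ḡ(N, N) = 0` follows `λ(A_N X) = -a λ(X)`. For `Z` in
the screen, `ḡ(Z, N) = 0` gives `g(A_N X, Z) = C(X, Z) - η(Z) λ(X) - a g(X, Z)`, and `ḡ(Z, E) = 0`
gives `B(X, Z) = g(A*_E X, Z)`, because `η(E) = 0` when `ξ` is tangent. The term `λ(X) η(PY)` in the
SAC condition cancels exactly `η(Z) λ(X)`. Both sides of the identity thus have the same `λ` and the
same products with the screen, which determine a tangent vector because the radical is the line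
spanned by `E`. -/

/-! ### Spectrum and symmetric functions of `c A - a` -/

open Polynomial in
/-- The characteristic polynomial of `c A - a`. -/
theorem charpoly_smul_sub_smul {V : Type*} [AddCommGroup V] [Module ℝ V]
    [Module.Finite ℝ V] (A : V →ₗ[ℝ] V) {c : ℝ} (hc : c ≠ 0) (a : ℝ) :
    (c • A - a • LinearMap.id).charpoly =
      C (c ^ Module.finrank ℝ V) * A.charpoly.comp (C c⁻¹ * (X + C a)) := by
  -- Over the infinite field `ℝ` it suffices to compare values: `t - (c A - a) = c (c⁻¹ (t + a) -
  -- A)`, and the determinant releases `c` to the power `dim V`.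
  refine Polynomial.funext fun t ↦ ?_
  rw [LinearMap.eval_charpoly, eval_mul, eval_C, eval_comp, LinearMap.eval_charpoly,
    ← LinearMap.det_smul]
  congr 1
  ext v
  simp only [eval_mul, eval_C, eval_add, eval_X, LinearMap.sub_apply, LinearMap.smul_apply,
    Module.algebraMap_end_apply, smul_sub, smul_smul, LinearMap.id_apply,
    mul_inv_cancel_left₀ hc, add_smul]
  abel

open Polynomial in
/-- If the eigenvalues of `A` are `κ₁, …, κ_k` then those of `c A - a` are `c κᵢ - a`. -/
theorem principalCurvatures_smul_sub_smul {K : Type*} [RCLike K] {V : Type*} [AddCommGroup V]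
    [Module ℝ V] [Module.Finite ℝ V] (A : V →ₗ[ℝ] V) {c : ℝ} (hc : c ≠ 0) (a : ℝ) {k : ℕ}
    (hk : Module.finrank ℝ V = k) (kappa : Fin k → K)
    (hkappa : (Finset.univ : Finset (Fin k)).val.map kappa = principalCurvatures K A) :
    principalCurvatures K (c • A - a • LinearMap.id) =
      (Finset.univ : Finset (Fin k)).val.map fun i ↦ (c : K) * kappa i - a := by
  have hmonic : (A.charpoly.map (algebraMap ℝ K)).Monic := A.charpoly_monic.map _
  have hA : A.charpoly.map (algebraMap ℝ K) = ∏ i, (X - C (kappa i)) := by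
    -- The family `kappa` lists `dim V` roots, as many as the degree, so the polynomial splits over
    -- `K`. This treats `K = ℝ` and `K = ℂ` alike.
    have hcard : (A.charpoly.map (algebraMap ℝ K)).roots.card
        = (A.charpoly.map (algebraMap ℝ K)).natDegree := by
      rw [A.charpoly_monic.natDegree_map, LinearMap.charpoly_natDegree, hk]
      have := congrArg Multiset.card hkappa
      simpa [principalCurvatures] using this.symm
    rw [← prod_multiset_X_sub_C_of_monic_of_roots_card_eq hmonic hcard]
    change (Multiset.map _ (principalCurvatures K A)).prod = _
    rw [← hkappa, Multiset.map_map]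
    rfl
  have key : (c • A - a • LinearMap.id).charpoly.map (algebraMap ℝ K) =
      ∏ i, (X - C ((c : K) * kappa i - a)) := by
    rw [charpoly_smul_sub_smul A hc, hk, Polynomial.map_mul, Polynomial.map_comp, hA,
      Polynomial.prod_comp, Polynomial.map_C]
    simp only [Polynomial.map_mul, Polynomial.map_C, Polynomial.map_add, Polynomial.map_X,
      sub_comp, X_comp, C_comp, map_pow]
    -- One factor `c` goes to each linear factor: `c (c⁻¹ (X + a) - κᵢ) = X - (c κᵢ - a)`.
    rw [show (C (algebraMap ℝ K c)) ^ k = ∏ _i : Fin k, C (algebraMap ℝ K c) by simp,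
      ← Finset.prod_mul_distrib]
    refine Finset.prod_congr rfl fun i _ ↦ ?_
    have h1 : C (algebraMap ℝ K c) * C (algebraMap ℝ K c⁻¹) = (1 : K[X]) := by
      rw [← C_mul, ← map_mul, mul_inv_cancel₀ hc, map_one, C_1]
    rw [mul_sub, ← mul_assoc, h1, one_mul, C_sub, C_mul]
    simp only [RCLike.algebraMap_eq_ofReal]
    ring
  rw [principalCurvatures, key]
  rw [← roots_multiset_prod_X_sub_C (Multiset.map _ _), Multiset.map_map]
  rfl

/-- `e_r(c κ - a)`, expanded in powers of `a` and `c`. -/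
theorem esymm_map_mul_sub_eq {K : Type*} [RCLike K] {n : ℕ} (kappa : Fin (n + 1) → K) {r : ℕ}
    (hr : 1 ≤ r) (a c : ℝ) :
    ((Finset.univ : Finset (Fin (n + 1))).val.map fun i ↦ (c : K) * kappa i - a).esymm r =
      (c : K) ^ r * ((Finset.univ : Finset (Fin (n + 1))).val.map kappa).esymm r
        + J kappa r a c := by
  rw [Finset.esymm_map_val, Finset.esymm_map_val, J, Finset.mul_sum, ← Finset.sum_add_distrib,
    ← Finset.sum_add_distrib]
  refine Finset.sum_congr rfl fun I hI ↦ ?_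
  have hcard : I.card = r := (Finset.mem_powersetCard.1 hI).2
  -- Vieta's formula for `∏ (X + c κᵢ)`, evaluated at `X = -a`; the sign `(-1)^(r-j)` is rewritten
  -- as `(-1)^(r+j)`.
  have hprod : ∏ i ∈ I, ((c : K) * kappa i - a) =
      ∑ j ∈ Finset.range (r + 1),
        (-1 : K) ^ (r + j) * (I.val.map kappa).esymm j * (a : K) ^ (r - j) * (c : K) ^ j := by
    have := congrArg (Polynomial.eval (-(a : K)))
      (Multiset.prod_X_add_C_eq_sum_esymm (I.val.map fun i ↦ (c : K) * kappa i))
    simp only [Polynomial.eval_multiset_prod, Multiset.map_map, Polynomial.eval_finsetSum,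
      Function.comp_def, Polynomial.eval_add, Polynomial.eval_X, Polynomial.eval_C,
      Polynomial.eval_mul, Polynomial.eval_pow, Multiset.card_map, Finset.card_val, hcard] at this
    rw [show ∏ i ∈ I, ((c : K) * kappa i - a) =
      (I.val.map fun i ↦ -(a : K) + (c : K) * kappa i).prod by
        rw [Finset.prod_map_val]; exact Finset.prod_congr rfl fun i _ ↦ by ring, this]
    refine Finset.sum_congr rfl fun j hj ↦ ?_
    have hj : j ≤ r := Nat.lt_succ_iff.1 (Finset.mem_range.1 hj)
    have h := Multiset.pow_smul_esymm (c : K) j (I.val.map kappa)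
    rw [Multiset.map_map] at h
    simp only [smul_eq_mul, Function.comp_def] at h
    rw [← h, neg_pow, show r + j = (r - j) + 2 * j by omega, pow_add, pow_mul]
    norm_num
    ring
  -- As `r ≥ 1`, the terms `j = r` and `j = 0` are distinct and can both be split off: the former
  -- belongs to `S*_r`, the latter is `(-1)^r a^r`.
  obtain ⟨r, rfl⟩ : ∃ t, r = t + 1 := ⟨r - 1, by omega⟩
  have hI : (I.val.map kappa).esymm (r + 1) = ∏ i ∈ I, kappa i := by
    rw [Finset.esymm_map_val, ← hcard, Finset.powersetCard_self, Finset.sum_singleton]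
  rw [hprod, Finset.sum_range_succ, Finset.range_eq_Ico,
    Finset.sum_eq_sum_Ico_succ_bot (Nat.succ_pos r), hI, Nat.sub_self, ← two_mul, pow_mul]
  simp [Multiset.esymm]
  ring

theorem contDiff_J {K : Type*} [RCLike K] {n : ℕ} (kappa : Fin (n + 1) → K) (r : ℕ) :
    ContDiff ℝ ∞ (fun q : ℝ × ℝ ↦ J kappa r q.1 q.2) := by
  have h1 : ContDiff ℝ ∞ (fun q : ℝ × ℝ ↦ (q.1 : K)) :=
    (RCLike.ofRealCLM (K := K)).contDiff.comp contDiff_fst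
  have h2 : ContDiff ℝ ∞ (fun q : ℝ × ℝ ↦ (q.2 : K)) :=
    (RCLike.ofRealCLM (K := K)).contDiff.comp contDiff_snd
  unfold J
  exact (ContDiff.sum fun I _ ↦ contDiff_const.mul (h1.pow r)).add
    (ContDiff.sum fun I _ ↦ ContDiff.sum fun j _ ↦
      (contDiff_const.mul (h1.pow _)).mul (h2.pow _))

/-! ### Product rule for operator-valued functions on a manifold -/

section NormedSpaceValued

variable {H M E₀ F G : Type*} [NormedAddCommGroup E₀] [NormedSpace ℝ E₀]
  [TopologicalSpace H] {I : ModelWithCorners ℝ E₀ H} [TopologicalSpace M] [ChartedSpace H M]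
  [NormedAddCommGroup F] [NormedSpace ℝ F] [NormedAddCommGroup G] [NormedSpace ℝ G]

/-- For normed-space targets the manifold derivative is the derivative of the chart representative,
so the vector-space product rule transfers. -/
theorem hasMFDerivAt_clm_apply {A : M → F →L[ℝ] G} {v : M → F} {p : M}
    (hA : MDifferentiableAt I 𝓘(ℝ, F →L[ℝ] G) A p) (hv : MDifferentiableAt I 𝓘(ℝ, F) v p) :
    HasMFDerivAt I 𝓘(ℝ, G) (fun q ↦ A q (v q)) p
      ((ContinuousLinearMap.apply ℝ G (v p) ∘L mvfderiv I A p + A p ∘L mvfderiv I v p :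
        TangentSpace I p →L[ℝ] G)) := by
  refine ⟨hA.continuousAt.clm_apply hv.continuousAt, ?_⟩
  have h := hA.hasMFDerivAt.2.clm_apply hv.hasMFDerivAt.2
  rw [show writtenInExtChartAt I 𝓘(ℝ, F →L[ℝ] G) p A (extChartAt I p p) = A p by simp only [mfld_simps]; rfl,
    show writtenInExtChartAt I 𝓘(ℝ, F) p v (extChartAt I p p) = v p by simp only [mfld_simps]; rfl, add_comm] at h
  exact h

theorem mvfderiv_clm_apply {A : M → F →L[ℝ] G} {v : M → F} {p : M}
    (hA : MDifferentiableAt I 𝓘(ℝ, F →L[ℝ] G) A p) (hv : MDifferentiableAt I 𝓘(ℝ, F) v p)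
    (X : TangentSpace I p) :
    mvfderiv I (fun q ↦ A q (v q)) p X = mvfderiv I A p X (v p) + A p (mvfderiv I v p X) := by
  rw [mvfderiv, (hasMFDerivAt_clm_apply hA hv).mfderiv]
  rfl

theorem mdifferentiableAt_clm_apply {A : M → F →L[ℝ] G} {v : M → F} {p : M}
    (hA : MDifferentiableAt I 𝓘(ℝ, F →L[ℝ] G) A p) (hv : MDifferentiableAt I 𝓘(ℝ, F) v p) :
    MDifferentiableAt I 𝓘(ℝ, G) (fun q ↦ A q (v q)) p :=
  (hasMFDerivAt_clm_apply hA hv).mdifferentiableAt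

theorem mvfderiv_congr {u v : M → F} {p : M} (h : u =ᶠ[𝓝 p] v) (X : TangentSpace I p) :
    mvfderiv I u p X = mvfderiv I v p X := by
  simp only [mvfderiv, h.mfderiv_eq]
  rfl

end NormedSpaceValued

/-! ### The pulled-back connection and the metric -/

section AlongMap

variable {m d : ℕ} {M : Type*} [TopologicalSpace M] [ChartedSpace (EuclideanSpace ℝ (Fin m)) M]
  {Mbar : Type*} [TopologicalSpace Mbar] [ChartedSpace (EuclideanSpace ℝ (Fin d)) Mbar]
  [IsManifold (𝓡 d) ∞ Mbar]

/-- Only the value and the derivative at `p` of the coordinates of the field enter. This allows `PZ`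
to be replaced by `Z` for a local section `Z` of the screen. -/
theorem covDerivAlong_congr
    (nabla : CovariantDerivative (𝓡 d) (EuclideanSpace ℝ (Fin d))
      (TangentSpace (𝓡 d) : Mbar → Type _))
    {f : M → Mbar} {V W : ∀ q : M, TangentSpace (𝓡 d) (f q)} {p : M}
    (h : ∀ᶠ q in 𝓝 p, V q = W q) :
    covDerivAlong (m := m) nabla f V p = covDerivAlong nabla f W p := by
  ext1 X
  simp only [covDerivAlong, add_apply, ContinuousLinearMap.comp_apply]
  rw [h.self_of_nhds, mvfderiv_congr (I := 𝓡 m) (h.mono fun q hq ↦ by rw [hq]) X]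

/-- The metric in the trivialization of the tangent bundle at `x`. -/
noncomputable def metricInCoord (g : SemiRiemannianMetric d Mbar) (x y : Mbar) :
    EuclideanSpace ℝ (Fin d) →L[ℝ] EuclideanSpace ℝ (Fin d) →L[ℝ] ℝ :=
  ContinuousLinearMap.inCoordinates (EuclideanSpace ℝ (Fin d)) (TangentSpace (𝓡 d) : Mbar → Type _)
    (EuclideanSpace ℝ (Fin d) →L[ℝ] ℝ) (fun x : Mbar ↦ TangentSpace (𝓡 d) x →L[ℝ] ℝ)
    x y x y (g.val y)

theorem metricInCoord_apply (g : SemiRiemannianMetric d Mbar) {x y : Mbar}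
    (hy : y ∈ (trivializationAt (EuclideanSpace ℝ (Fin d))
      (TangentSpace (𝓡 d) : Mbar → Type _) x).baseSet) (v w : EuclideanSpace ℝ (Fin d)) :
    metricInCoord g x y v w = g.val y
      ((trivializationAt (EuclideanSpace ℝ (Fin d)) (TangentSpace (𝓡 d) : Mbar → Type _) x).symm y v)
      ((trivializationAt (EuclideanSpace ℝ (Fin d)) (TangentSpace (𝓡 d) : Mbar → Type _) x).symm y w) := by
  have := inCoordinates_apply_eq₂ (F₃ := ℝ) (E₃ := fun _ : Mbar ↦ ℝ) (𝕜 := ℝ)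
    (ϕ := g.val y) (v := v) (w := w) hy hy (Set.mem_univ _)
  simpa [metricInCoord] using this

theorem mdifferentiableAt_metricInCoord (g : SemiRiemannianMetric d Mbar) (x : Mbar) :
    MDifferentiableAt (𝓡 d)
      𝓘(ℝ, EuclideanSpace ℝ (Fin d) →L[ℝ] EuclideanSpace ℝ (Fin d) →L[ℝ] ℝ)
      (metricInCoord g x) x := by
  have h := (g.contMDiff.mdifferentiable (by simp)) x
  rw [mdifferentiableAt_section] at h
  exact h

/-- The coordinates of such a field are constant on the base set. It is therefore an admissible
argument of `deriv_metric`. -/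
theorem mdifferentiableAt_trivializationAt_symm (x : Mbar) (v : EuclideanSpace ℝ (Fin d)) :
    MDifferentiableAt (𝓡 d) (𝓡 d).tangent
      (fun y ↦ (⟨y, (trivializationAt (EuclideanSpace ℝ (Fin d))
        (TangentSpace (𝓡 d) : Mbar → Type _) x).symm y v⟩ : TangentBundle (𝓡 d) Mbar)) x := by
  rw [mdifferentiableAt_section]
  refine (mdifferentiableAt_const (c := v)).congr_of_eventuallyEq ?_
  filter_upwards [(trivializationAt (EuclideanSpace ℝ (Fin d))
    (TangentSpace (𝓡 d) : Mbar → Type _) x).open_baseSet.mem_nhds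
      (FiberBundle.mem_baseSet_trivializationAt' x)] with y hy
  rw [Bundle.Trivialization.apply_mk_symm _ hy]

/-- The derivative of `ḡ(V, W)` for vector fields `V`, `W` along a map, with respect to the
pull-back of a semi-symmetric non-metric connection. -/
theorem mvfderiv_metric_along {s : AlmostContactMetricStructure d Mbar}
    {nabla : CovariantDerivative (𝓡 d) (EuclideanSpace ℝ (Fin d))
      (TangentSpace (𝓡 d) : Mbar → Type _)} (h : IsSemiSymmetricNonMetric s nabla)
    {f : M → Mbar} {V W : ∀ q : M, TangentSpace (𝓡 d) (f q)} {p : M}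
    (hV : MDifferentiableAt (𝓡 m) (𝓡 d).tangent
      (fun q ↦ (⟨f q, V q⟩ : TangentBundle (𝓡 d) Mbar)) p)
    (hW : MDifferentiableAt (𝓡 m) (𝓡 d).tangent
      (fun q ↦ (⟨f q, W q⟩ : TangentBundle (𝓡 d) Mbar)) p) (X : TangentSpace (𝓡 m) p) :
    mvfderiv (𝓡 m) (fun q ↦ s.g.val (f q) (V q) (W q)) p X =
      s.g.val (f p) (covDerivAlong nabla f V p X) (W p)
        + s.g.val (f p) (V p) (covDerivAlong nabla f W p X)
        - s.eta (f p) (V p) * s.g.val (f p) (mfderiv (𝓡 m) (𝓡 d) f p X) (W p)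
        - s.eta (f p) (W p) * s.g.val (f p) (mfderiv (𝓡 m) (𝓡 d) f p X) (V p) := by
  set e := trivializationAt (EuclideanSpace ℝ (Fin d)) (TangentSpace (𝓡 d) : Mbar → Type _) (f p)
    with he
  have hV' := (mdifferentiableAt_totalSpace (𝓡 d) _).1 hV
  have hW' := (mdifferentiableAt_totalSpace (𝓡 d) _).1 hW
  have hf : MDifferentiableAt (𝓡 m) (𝓡 d) f p := hV'.1
  have hbase : e.baseSet ∈ 𝓝 (f p) :=
    e.open_baseSet.mem_nhds (FiberBundle.mem_baseSet_trivializationAt' (f p))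
  have hp : f p ∈ e.baseSet := mem_of_mem_nhds hbase
  have symmL_eq : ∀ v, e.symmL ℝ (f p) v = e.symm (f p) v := fun v ↦ e.symmL_apply hp v
  have hG := mdifferentiableAt_metricInCoord s.g (f p)
  have hGf : MDifferentiableAt (𝓡 m)
      𝓘(ℝ, EuclideanSpace ℝ (Fin d) →L[ℝ] EuclideanSpace ℝ (Fin d) →L[ℝ] ℝ)
      (fun q ↦ metricInCoord s.g (f p) (f q)) p := hG.comp p hf
  have symm_coord : ∀ (Z : ∀ q : M, TangentSpace (𝓡 d) (f q)) {q : M}, f q ∈ e.baseSet →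
      e.symm (f q) (e ⟨f q, Z q⟩).2 = Z q := fun Z q hq ↦ e.symm_apply_apply_mk hq _
  have hloc : (fun q ↦ s.g.val (f q) (V q) (W q)) =ᶠ[𝓝 p] fun q ↦
      metricInCoord s.g (f p) (f q) (e ⟨f q, V q⟩).2 (e ⟨f q, W q⟩).2 := by
    filter_upwards [hf.continuousAt hbase] with q hq
    rw [metricInCoord_apply s.g hq, symm_coord V hq, symm_coord W hq]
  have hcomp : ∀ X : TangentSpace (𝓡 m) p,
      mvfderiv (𝓡 m) (fun q ↦ metricInCoord s.g (f p) (f q)) p X =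
        mvfderiv (𝓡 d) (metricInCoord s.g (f p)) (f p) (mfderiv (𝓡 m) (𝓡 d) f p X) :=
    fun X ↦ mfderiv_comp_apply p hG hf X
  -- With `v`, `w` frozen, differentiating the coordinate matrix of `ḡ` is differentiating `ḡ` on
  -- frame fields with constant coefficients.
  have hmet : ∀ (u : TangentSpace (𝓡 d) (f p)) (v w : EuclideanSpace ℝ (Fin d)),
      mvfderiv (𝓡 d) (metricInCoord s.g (f p)) (f p) u v w =
        mvfderiv (𝓡 d) (fun y ↦ s.g.val y (e.symm y v) (e.symm y w)) (f p) u := by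
    intro u v w
    have h1 : (fun y ↦ s.g.val y (e.symm y v) (e.symm y w)) =ᶠ[𝓝 (f p)]
        fun y ↦ metricInCoord s.g (f p) y v w := by
      filter_upwards [hbase] with y hy
      rw [metricInCoord_apply s.g hy]
    rw [mvfderiv_congr h1, mvfderiv_clm_apply
      (mdifferentiableAt_clm_apply hG mdifferentiableAt_const) mdifferentiableAt_const,
      mvfderiv_clm_apply hG mdifferentiableAt_const]
    simp [mvfderiv_const]
  -- The hypothesis on the connection is applied to the constant-coefficient fields that agree with
  -- `V` and `W` at `f p`.
  have hd := h.deriv_metric (f p) (mfderiv (𝓡 m) (𝓡 d) f p X) _ _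
    (mdifferentiableAt_trivializationAt_symm (f p) (e ⟨f p, V p⟩).2)
    (mdifferentiableAt_trivializationAt_symm (f p) (e ⟨f p, W p⟩).2)
  simp only [← he, symm_coord V hp, symm_coord W hp] at hd
  -- In the product rule the derivatives of the coordinates match the first summand of
  -- `covDerivAlong`; the derivative of the metric matches the second through `hd`.
  rw [mvfderiv_congr hloc, mvfderiv_clm_apply (mdifferentiableAt_clm_apply hGf hV'.2) hW'.2,
    mvfderiv_clm_apply hGf hV'.2, add_apply, hcomp, hmet,
    metricInCoord_apply s.g hp, metricInCoord_apply s.g hp]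
  simp only [covDerivAlong, ← he, add_apply, ContinuousLinearMap.comp_apply,
    map_add, symmL_eq, symm_coord V hp, symm_coord W hp]
  linear_combination hd

end AlongMap

/-- Compatibility of `ḡ` with `φ̄` is taken at `w = ξ`, where `φ̄ ξ = 0`. It yields `η(E) = 0` for
tangent `ξ`. -/
theorem AlmostContactMetricStructure.eta_eq {d : ℕ} {Mbar : Type*} [TopologicalSpace Mbar]
    [ChartedSpace (EuclideanSpace ℝ (Fin d)) Mbar] [IsManifold (𝓡 d) ∞ Mbar]
    (s : AlmostContactMetricStructure d Mbar) (x : Mbar) (v : TangentSpace (𝓡 d) x) :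
    s.eta x v = s.g.val x v (s.xi x) := by
  have h := s.g_phi_phi x v (s.xi x)
  rw [s.phi_xi, s.eta_xi, map_zero] at h
  linarith

/-! ### Linear algebra of the lightlike frame -/

section HalfLightlike

variable {n : ℕ} {M : Type*} [TopologicalSpace M]
  [ChartedSpace (EuclideanSpace ℝ (Fin (n + 1))) M] [IsManifold (𝓡 (n + 1)) ∞ M]
  {Mbar : Type*} [TopologicalSpace Mbar] [ChartedSpace (EuclideanSpace ℝ (Fin (n + 3))) Mbar]
  [IsManifold (𝓡 (n + 3)) ∞ Mbar]

/-- The push-forward along `f` of a differentiable vector field is a differentiable vector field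
along `f`. -/
theorem mdifferentiableAt_mfderiv_apply {f : M → Mbar}
    (hf : ContMDiff (𝓡 (n + 1)) (𝓡 (n + 3)) ∞ f) {Y : ∀ q : M, TangentSpace (𝓡 (n + 1)) q} {p : M}
    (hY : MDifferentiableAt (𝓡 (n + 1)) (𝓡 (n + 1)).tangent
      (fun q ↦ (⟨q, Y q⟩ : TangentBundle (𝓡 (n + 1)) M)) p) :
    MDifferentiableAt (𝓡 (n + 1)) (𝓡 (n + 3)).tangent
      (fun q ↦ (⟨f q, mfderiv (𝓡 (n + 1)) (𝓡 (n + 3)) f q (Y q)⟩ :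
        TangentBundle (𝓡 (n + 3)) Mbar)) p :=
  MDifferentiableAt.comp p
    ((hf.contMDiff_tangentMap (m := 1) (by decide)).mdifferentiable (by simp) _) hY

namespace LightlikeFrame

variable {g : SemiRiemannianMetric (n + 3) Mbar} {f : M → Mbar}
  {S : ∀ p : M, Submodule ℝ (TangentSpace (𝓡 (n + 1)) p)} {U : Set M}
  (F : LightlikeFrame g f S U) {p : M}

theorem val_mfderiv_E (hp : p ∈ U) (X : TangentSpace (𝓡 (n + 1)) p) :
    g.val (f p) (mfderiv (𝓡 (n + 1)) (𝓡 (n + 3)) f p X)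
      (mfderiv (𝓡 (n + 1)) (𝓡 (n + 3)) f p (F.E p)) = 0 :=
  F.E_mem p hp X

theorem val_mfderiv_W (hp : p ∈ U) (X : TangentSpace (𝓡 (n + 1)) p) :
    g.val (f p) (mfderiv (𝓡 (n + 1)) (𝓡 (n + 3)) f p X) (F.W p) = 0 :=
  F.W_mem p hp X

theorem val_W_self_ne_zero (hp : p ∈ U) : g.val (f p) (F.W p) (F.W p) ≠ 0 := by
  rcases F.W_unit p hp with h | h <;> rw [h] <;> norm_num

theorem lam_E (hp : p ∈ U) : F.lam p (F.E p) = 1 := by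
  rw [lam, ContinuousLinearMap.comp_apply, g.symm]
  exact F.E_N p hp

theorem lam_apply (X : TangentSpace (𝓡 (n + 1)) p) :
    F.lam p X = g.val (f p) (mfderiv (𝓡 (n + 1)) (𝓡 (n + 3)) f p X) (F.N p) := by
  rw [lam, ContinuousLinearMap.comp_apply, g.symm]

theorem lam_of_mem_screen (hp : p ∈ U) {Z : TangentSpace (𝓡 (n + 1)) p} (hZ : Z ∈ S p) :
    F.lam p Z = 0 := by
  rw [lam_apply]
  exact F.N_screen p hp Z hZ

theorem screenProj_apply (X : TangentSpace (𝓡 (n + 1)) p) :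
    F.screenProj p X = X - F.lam p X • F.E p := rfl

theorem lam_screenProj (hp : p ∈ U) (X : TangentSpace (𝓡 (n + 1)) p) :
    F.lam p (F.screenProj p X) = 0 := by
  rw [screenProj_apply, map_sub, map_smul, F.lam_E hp, smul_eq_mul, mul_one, sub_self]

/-- A radical vector annihilated by `λ` vanishes. -/
theorem eq_zero_of_mem_radical (hf : IsHalfLightlike g f) (hp : p ∈ U)
    {X : TangentSpace (𝓡 (n + 1)) p} (hX : X ∈ radical (m := n + 1) g f p)
    (hl : F.lam p X = 0) : X = 0 := by
  -- The radical is a line, so `X = c E`, and `λ(E) = 1` identifies `c` with `λ(X)`.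
  obtain ⟨c, hc⟩ := (finrank_eq_one_iff_of_nonzero' (⟨F.E p, F.E_mem p hp⟩ :
    radical (m := n + 1) g f p) (by simpa [Subtype.ext_iff] using F.E_ne_zero p hp)).1
      (hf.finrank_radical p) ⟨X, hX⟩
  have hc' : c • F.E p = X := congrArg Subtype.val hc
  rw [← hc', map_smul, F.lam_E hp, smul_eq_mul, mul_one] at hl
  rw [← hc', hl, zero_smul]

/-- A vector annihilated by `λ` and orthogonal to the screen vanishes. -/
theorem eq_zero_of_orthogonal_screen (hf : IsHalfLightlike g f) (hS : IsScreenDistribution g f S)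
    (hp : p ∈ U) {X : TangentSpace (𝓡 (n + 1)) p} (hl : F.lam p X = 0)
    (h : ∀ Z ∈ S p, g.val (f p) (mfderiv (𝓡 (n + 1)) (𝓡 (n + 3)) f p X)
      (mfderiv (𝓡 (n + 1)) (𝓡 (n + 3)) f p Z) = 0) : X = 0 := by
  refine F.eq_zero_of_mem_radical hf hp (fun Y ↦ ?_) hl
  -- Every tangent vector is radical plus screen, and the radical part pairs to zero with `X`
  -- anyway; hence `X` is itself radical.
  obtain ⟨R, hR, Z, hZ, rfl⟩ := Submodule.mem_sup.1
    ((hS.isCompl p).sup_eq_top ▸ Submodule.mem_top : Y ∈ radical (m := n + 1) g f p ⊔ S p)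
  change g.val (f p) (mfderiv (𝓡 (n + 1)) (𝓡 (n + 3)) f p (R + Z))
    (mfderiv (𝓡 (n + 1)) (𝓡 (n + 3)) f p X) = 0
  rw [g.symm, map_add, map_add, h Z hZ, add_zero]
  exact hR X

/-- The map `(X, b, c) ↦ df X + b N + c W`. -/
noncomputable def sumMap (p : M) :
    TangentSpace (𝓡 (n + 1)) p × ℝ × ℝ →L[ℝ] TangentSpace (𝓡 (n + 3)) (f p) :=
  (mfderiv (𝓡 (n + 1)) (𝓡 (n + 3)) f p).coprod
    ((ContinuousLinearMap.toSpanSingleton ℝ (F.N p)).coprod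
      (ContinuousLinearMap.toSpanSingleton ℝ (F.W p)))

theorem sumMap_apply (x : TangentSpace (𝓡 (n + 1)) p × ℝ × ℝ) :
    F.sumMap p x = mfderiv (𝓡 (n + 1)) (𝓡 (n + 3)) f p x.1 + (x.2.1 • F.N p + x.2.2 • F.W p) :=
  rfl

/-- This and the next three pairings make the decomposition explicit: `E` detects `b`, `N` detects
`λ(X)`, `W` detects `c` up to sign, and the screen sees only `X`. -/
theorem val_sumMap_E (hp : p ∈ U) (x : TangentSpace (𝓡 (n + 1)) p × ℝ × ℝ) :
    g.val (f p) (F.sumMap p x) (mfderiv (𝓡 (n + 1)) (𝓡 (n + 3)) f p (F.E p)) = x.2.1 := by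
  rw [sumMap_apply]
  simp only [map_add, map_smul, add_apply, smul_apply, smul_eq_mul]
  rw [F.val_mfderiv_E hp, g.symm _ (F.N p), F.E_N p hp, g.symm _ (F.W p), F.val_mfderiv_W hp]
  ring

theorem val_sumMap_N (hp : p ∈ U) (x : TangentSpace (𝓡 (n + 1)) p × ℝ × ℝ) :
    g.val (f p) (F.sumMap p x) (F.N p) = F.lam p x.1 := by
  rw [sumMap_apply]
  simp only [map_add, map_smul, add_apply, smul_apply, smul_eq_mul]
  rw [F.N_null p hp, g.symm _ (F.W p), F.N_W p hp, lam_apply]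
  ring

theorem val_sumMap_W (hp : p ∈ U) (x : TangentSpace (𝓡 (n + 1)) p × ℝ × ℝ) :
    g.val (f p) (F.sumMap p x) (F.W p) = x.2.2 * g.val (f p) (F.W p) (F.W p) := by
  rw [sumMap_apply]
  simp only [map_add, map_smul, add_apply, smul_apply, smul_eq_mul]
  rw [F.val_mfderiv_W hp, F.N_W p hp]
  ring

theorem val_sumMap_screen (hp : p ∈ U) (x : TangentSpace (𝓡 (n + 1)) p × ℝ × ℝ)
    {Z : TangentSpace (𝓡 (n + 1)) p} (hZ : Z ∈ S p) :
    g.val (f p) (F.sumMap p x) (mfderiv (𝓡 (n + 1)) (𝓡 (n + 3)) f p Z) =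
      g.val (f p) (mfderiv (𝓡 (n + 1)) (𝓡 (n + 3)) f p x.1)
        (mfderiv (𝓡 (n + 1)) (𝓡 (n + 3)) f p Z) := by
  rw [sumMap_apply]
  simp only [map_add, map_smul, add_apply, smul_apply, smul_eq_mul]
  rw [g.symm _ (F.N p), F.N_screen p hp Z hZ, g.symm _ (F.W p), F.val_mfderiv_W hp]
  ring

/-- Pairing a kernel element with `E`, `N`, `W` gives `b = 0`, `λ(X) = 0`, `c = 0`. What remains is
`df X = 0`, so `X` is radical and killed by `λ`. -/
theorem sumMap_injective (hf : IsHalfLightlike g f) (hp : p ∈ U) :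
    Function.Injective (F.sumMap p) := by
  refine (injective_iff_map_eq_zero (F.sumMap p)).2 fun x hx ↦ ?_
  have hE := F.val_sumMap_E hp x
  have hN := F.val_sumMap_N hp x
  have hW := F.val_sumMap_W hp x
  simp only [hx, map_zero, zero_apply] at hE hN hW
  have hc : x.2.2 = 0 := (mul_eq_zero.1 hW.symm).resolve_right (F.val_W_self_ne_zero hp)
  have hdf : mfderiv (𝓡 (n + 1)) (𝓡 (n + 3)) f p x.1 = 0 := by
    have h := F.sumMap_apply x
    rw [hx, ← hE, hc, zero_smul, zero_smul, add_zero, add_zero] at h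
    exact h.symm
  have h1 : x.1 = 0 := F.eq_zero_of_mem_radical hf hp (fun Y ↦ by
    change g.val (f p) _ (mfderiv (𝓡 (n + 1)) (𝓡 (n + 3)) f p x.1) = 0
    rw [hdf, map_zero]) hN.symm
  exact Prod.ext h1 (Prod.ext hE.symm hc)

/-- `df X + b N + c W` with `(X, b, c)` the components of `v` recovers `v`. -/
theorem sumMap_decomp (hf : IsHalfLightlike g f) (hp : p ∈ U)
    (v : TangentSpace (𝓡 (n + 3)) (f p)) : F.sumMap p (F.decomp p v) = v := by
  have hm : Module.finrank ℝ (TangentSpace (𝓡 (n + 1)) p) = n + 1 :=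
    finrank_euclideanSpace_fin (𝕜 := ℝ)
  have hd : Module.finrank ℝ (TangentSpace (𝓡 (n + 3)) (f p)) = n + 3 :=
    finrank_euclideanSpace_fin (𝕜 := ℝ)
  have hinj := F.sumMap_injective hf hp
  have hdim : Module.finrank ℝ (TangentSpace (𝓡 (n + 1)) p × ℝ × ℝ) =
      Module.finrank ℝ (TangentSpace (𝓡 (n + 3)) (f p)) := by
    rw [Module.finrank_prod, Module.finrank_prod, hm, hd, Module.finrank_self]
  -- `ContinuousLinearMap.inverse` is zero by default on non-invertible maps, so invertibility is
  -- needed: injectivity together with `(n + 1) + 1 + 1 = n + 3`.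
  let T : (EuclideanSpace ℝ (Fin (n + 1)) × ℝ × ℝ) →L[ℝ] EuclideanSpace ℝ (Fin (n + 3)) :=
    F.sumMap p
  let L : (EuclideanSpace ℝ (Fin (n + 1)) × ℝ × ℝ) ≃L[ℝ] EuclideanSpace ℝ (Fin (n + 3)) :=
    (LinearEquiv.ofInjectiveOfFinrankEq T.toLinearMap hinj hdim).toContinuousLinearEquiv
  have hL : (L : (EuclideanSpace ℝ (Fin (n + 1)) × ℝ × ℝ) →L[ℝ] EuclideanSpace ℝ (Fin (n + 3))) =
      T := ContinuousLinearMap.ext fun _ ↦ rfl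
  have hdec : ContinuousLinearMap.inverse T = L.symm := by
    rw [← hL, ContinuousLinearMap.inverse_equiv]
  have hT : T (ContinuousLinearMap.inverse T v) = v := by
    rw [hdec]
    exact L.apply_symm_apply v
  exact hT

end LightlikeFrame

end HalfLightlike

section HalfLightlike

variable {n : ℕ} {M : Type*} [TopologicalSpace M]
  [ChartedSpace (EuclideanSpace ℝ (Fin (n + 1))) M] [IsManifold (𝓡 (n + 1)) ∞ M]
  {Mbar : Type*} [TopologicalSpace Mbar] [ChartedSpace (EuclideanSpace ℝ (Fin (n + 3))) Mbar]
  [IsManifold (𝓡 (n + 3)) ∞ Mbar]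

namespace LightlikeFrame

variable {g : SemiRiemannianMetric (n + 3) Mbar} {f : M → Mbar}
  {S : ∀ p : M, Submodule ℝ (TangentSpace (𝓡 (n + 1)) p)} {U : Set M}
  (F : LightlikeFrame g f S U) {p : M}

theorem val_eq_E (hf : IsHalfLightlike g f) (hp : p ∈ U) (v : TangentSpace (𝓡 (n + 3)) (f p)) :
    g.val (f p) v (mfderiv (𝓡 (n + 1)) (𝓡 (n + 3)) f p (F.E p)) = (F.decomp p v).2.1 := by
  rw [← F.val_sumMap_E hp, F.sumMap_decomp hf hp]

theorem val_eq_N (hf : IsHalfLightlike g f) (hp : p ∈ U) (v : TangentSpace (𝓡 (n + 3)) (f p)) :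
    g.val (f p) v (F.N p) = F.lam p (F.decomp p v).1 := by
  rw [← F.val_sumMap_N hp, F.sumMap_decomp hf hp]

theorem val_eq_screen (hf : IsHalfLightlike g f) (hp : p ∈ U)
    (v : TangentSpace (𝓡 (n + 3)) (f p)) {Z : TangentSpace (𝓡 (n + 1)) p} (hZ : Z ∈ S p) :
    g.val (f p) v (mfderiv (𝓡 (n + 1)) (𝓡 (n + 3)) f p Z) =
      g.val (f p) (mfderiv (𝓡 (n + 1)) (𝓡 (n + 3)) f p (F.decomp p v).1)
        (mfderiv (𝓡 (n + 1)) (𝓡 (n + 3)) f p Z) := by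
  rw [← F.val_sumMap_screen hp _ hZ, F.sumMap_decomp hf hp]

theorem mdifferentiableAt_E (hU : IsOpen U) (hp : p ∈ U) :
    MDifferentiableAt (𝓡 (n + 1)) (𝓡 (n + 1)).tangent
      (fun q ↦ (⟨q, F.E q⟩ : TangentBundle (𝓡 (n + 1)) M)) p :=
  (F.contMDiffOn_E.contMDiffAt (hU.mem_nhds hp)).mdifferentiableAt (by simp)

theorem mdifferentiableAt_N (hU : IsOpen U) (hp : p ∈ U) :
    MDifferentiableAt (𝓡 (n + 1)) (𝓡 (n + 3)).tangent
      (fun q ↦ (⟨f q, F.N q⟩ : TangentBundle (𝓡 (n + 3)) Mbar)) p :=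
  (F.contMDiffOn_N.contMDiffAt (hU.mem_nhds hp)).mdifferentiableAt (by simp)

end LightlikeFrame

/-! ### The shape operators and the identity `A_N = φ A*_E - η(N)` -/

section SemiSymmetric

variable {s : AlmostContactMetricStructure (n + 3) Mbar}
  {nabla : CovariantDerivative (𝓡 (n + 3)) (EuclideanSpace ℝ (Fin (n + 3)))
    (TangentSpace (𝓡 (n + 3)) : Mbar → Type _)}
  {f : M → Mbar} {S : ∀ p : M, Submodule ℝ (TangentSpace (𝓡 (n + 1)) p)} {U : Set M}
  (F : LightlikeFrame s.g f S U) {p : M}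

namespace LightlikeFrame

/-- `λ(A_N X) = -η(N) λ(X)`. -/
theorem lam_shapeN (hnabla : IsSemiSymmetricNonMetric s nabla) (hf : IsHalfLightlike s.g f)
    (hU : IsOpen U) (hp : p ∈ U) (X : TangentSpace (𝓡 (n + 1)) p) :
    F.lam p (F.shapeN nabla p X) = -(s.eta (f p) (F.N p) * F.lam p X) := by
  have hN := F.mdifferentiableAt_N hU hp
  -- Derivative of `ḡ(N, N) = 0`; the non-metric terms contribute `-2 η(N) λ(X)`.
  have h := mvfderiv_metric_along hnabla hN hN X
  have h0 : (fun q ↦ s.g.val (f q) (F.N q) (F.N q)) =ᶠ[𝓝 p] fun _ ↦ (0 : ℝ) := by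
    filter_upwards [hU.mem_nhds hp] with q hq using F.N_null q hq
  rw [mvfderiv_congr h0, mvfderiv_const, zero_apply, s.g.symm _ (F.N p), F.val_eq_N hf hp,
    ← F.lam_apply] at h
  have hA : F.shapeN nabla p X = -(F.decomp p (covDerivAlong nabla f F.N p X)).1 := rfl
  rw [hA, map_neg]
  linarith

/-- The components of `A_N X` along the screen:
`g(A_N X, Z) = C(X, Z) - η(Z) λ(X) - η(N) g(X, Z)` for sections `Z` of the screen. -/
theorem val_shapeN (hnabla : IsSemiSymmetricNonMetric s nabla) (hf : IsHalfLightlike s.g f)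
    (hU : IsOpen U) (hp : p ∈ U) (X : TangentSpace (𝓡 (n + 1)) p)
    {Z : ∀ q : M, TangentSpace (𝓡 (n + 1)) q}
    (hZ : MDifferentiableAt (𝓡 (n + 1)) (𝓡 (n + 1)).tangent
      (fun q ↦ (⟨q, Z q⟩ : TangentBundle (𝓡 (n + 1)) M)) p)
    (hZS : ∀ᶠ q in 𝓝 p, Z q ∈ S q) :
    s.g.val (f p) (mfderiv (𝓡 (n + 1)) (𝓡 (n + 3)) f p (F.shapeN nabla p X))
        (mfderiv (𝓡 (n + 1)) (𝓡 (n + 3)) f p (Z p)) =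
      F.formC nabla p X Z
        - F.lam p X * s.eta (f p) (mfderiv (𝓡 (n + 1)) (𝓡 (n + 3)) f p (Z p))
        - s.eta (f p) (F.N p) * s.g.val (f p) (mfderiv (𝓡 (n + 1)) (𝓡 (n + 3)) f p X)
          (mfderiv (𝓡 (n + 1)) (𝓡 (n + 3)) f p (Z p)) := by
  -- Derivative of `ḡ(Z, N) = 0`.
  have h := mvfderiv_metric_along hnabla (mdifferentiableAt_mfderiv_apply hf.isImmersion.contMDiff hZ)
    (F.mdifferentiableAt_N hU hp) X
  have h0 : (fun q ↦ s.g.val (f q) (mfderiv (𝓡 (n + 1)) (𝓡 (n + 3)) f q (Z q)) (F.N q))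
      =ᶠ[𝓝 p] fun _ ↦ (0 : ℝ) := by
    filter_upwards [hU.mem_nhds hp, hZS] with q hq hZq using F.N_screen q hq _ hZq
  -- `formC` differentiates `PZ`, which equals `Z` near `p`.
  have hP : ∀ᶠ q in 𝓝 p, mfderiv (𝓡 (n + 1)) (𝓡 (n + 3)) f q (F.screenProj q (Z q)) =
      mfderiv (𝓡 (n + 1)) (𝓡 (n + 3)) f q (Z q) := by
    filter_upwards [hU.mem_nhds hp, hZS] with q hq hZq
    rw [F.screenProj_apply, F.lam_of_mem_screen hq hZq, zero_smul, sub_zero]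
  have hC : F.formC nabla p X Z = F.lam p (F.decomp p (covDerivAlong nabla f
      (fun q ↦ mfderiv (𝓡 (n + 1)) (𝓡 (n + 3)) f q (Z q)) p X)).1 := by
    rw [← covDerivAlong_congr nabla hP]
    rfl
  have hA : F.shapeN nabla p X = -(F.decomp p (covDerivAlong nabla f F.N p X)).1 := rfl
  rw [mvfderiv_congr h0, mvfderiv_const, zero_apply, F.val_eq_N hf hp, ← hC,
    s.g.symm _ _ (covDerivAlong nabla f F.N p X), F.val_eq_screen hf hp _ hZS.self_of_nhds,
    ← F.lam_apply] at h
  rw [hA, map_neg, map_neg, neg_apply]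
  linarith

/-- When `ξ` is tangent to the submanifold, `B(X, Z) = g(A*_E X, Z)` for sections `Z` of the
screen. -/
theorem formB_eq_val_shapeE (hnabla : IsSemiSymmetricNonMetric s nabla)
    (hf : IsHalfLightlike s.g f) (hU : IsOpen U) (hp : p ∈ U)
    (hxi : ∃ Y : TangentSpace (𝓡 (n + 1)) p,
      mfderiv (𝓡 (n + 1)) (𝓡 (n + 3)) f p Y = s.xi (f p))
    (X : TangentSpace (𝓡 (n + 1)) p) {Z : ∀ q : M, TangentSpace (𝓡 (n + 1)) q}
    (hZ : MDifferentiableAt (𝓡 (n + 1)) (𝓡 (n + 1)).tangent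
      (fun q ↦ (⟨q, Z q⟩ : TangentBundle (𝓡 (n + 1)) M)) p)
    (hZS : ∀ᶠ q in 𝓝 p, Z q ∈ S q) :
    F.formB nabla p X Z =
      s.g.val (f p) (mfderiv (𝓡 (n + 1)) (𝓡 (n + 3)) f p (F.shapeE nabla p X))
        (mfderiv (𝓡 (n + 1)) (𝓡 (n + 3)) f p (Z p)) := by
  -- Derivative of `ḡ(Z, E) = 0`; both non-metric terms vanish, since `η(E) = 0` and `g(X, E) = 0`.
  have h := mvfderiv_metric_along hnabla (mdifferentiableAt_mfderiv_apply hf.isImmersion.contMDiff hZ)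
    (mdifferentiableAt_mfderiv_apply hf.isImmersion.contMDiff (F.mdifferentiableAt_E hU hp)) X
  have h0 : (fun q ↦ s.g.val (f q) (mfderiv (𝓡 (n + 1)) (𝓡 (n + 3)) f q (Z q))
      (mfderiv (𝓡 (n + 1)) (𝓡 (n + 3)) f q (F.E q))) =ᶠ[𝓝 p] fun _ ↦ (0 : ℝ) := by
    filter_upwards [hU.mem_nhds hp] with q hq using F.val_mfderiv_E hq _
  have hE : s.eta (f p) (mfderiv (𝓡 (n + 1)) (𝓡 (n + 3)) f p (F.E p)) = 0 := by
    obtain ⟨Y, hY⟩ := hxi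
    rw [s.eta_eq, ← hY, s.g.symm, F.val_mfderiv_E hp]
  have hB : F.formB nabla p X Z = (F.decomp p (covDerivAlong nabla f
      (fun q ↦ mfderiv (𝓡 (n + 1)) (𝓡 (n + 3)) f q (Z q)) p X)).2.1 := rfl
  have hA : F.shapeE nabla p X = -F.screenProj p (F.decomp p (covDerivAlong nabla f
      (fun q ↦ mfderiv (𝓡 (n + 1)) (𝓡 (n + 3)) f q (F.E q)) p X)).1 := rfl
  rw [mvfderiv_congr h0, mvfderiv_const, zero_apply, F.val_eq_E hf hp, ← hB, hE,
    s.g.symm _ _ (covDerivAlong nabla f (fun q ↦ mfderiv _ _ f q (F.E q)) p X),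
    F.val_eq_screen hf hp _ hZS.self_of_nhds, F.val_mfderiv_E hp] at h
  -- The projection in `A*_E` changes the vector by a multiple of `E`, which `g` does not see.
  rw [hA, F.screenProj_apply]
  simp only [map_neg, map_sub, map_smul, neg_apply, sub_apply, smul_apply]
  rw [s.g.symm _ (mfderiv _ _ f p (F.E p)), F.val_mfderiv_E hp, smul_zero]
  linarith

/-- On a screen almost conformal half-lightlike submanifold, `A_N = φ A*_E - η(N)`. -/
theorem IsSAC.shapeN_eq (hnabla : IsSemiSymmetricNonMetric s nabla)
    (hf : IsHalfLightlike s.g f) (hS : IsScreenDistribution s.g f S) (hU : IsOpen U)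
    {F : LightlikeFrame s.g f S U} {phi : M → ℝ} (hSAC : IsSAC s F nabla phi) (hp : p ∈ U)
    (X : TangentSpace (𝓡 (n + 1)) p) :
    F.shapeN nabla p X = phi p • F.shapeE nabla p X - s.eta (f p) (F.N p) • X := by
  rw [← sub_eq_zero]
  refine F.eq_zero_of_orthogonal_screen hf hS hp ?_ fun Y hY ↦ ?_
  · have hE : F.lam p (F.shapeE nabla p X) = 0 := by
      have hA : F.shapeE nabla p X = -F.screenProj p (F.inducedConnection nabla F.E p X) := rfl
      rw [hA, map_neg, F.lam_screenProj hp, neg_zero]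
    simp only [map_sub, map_smul, F.lam_shapeN hnabla hf hU hp, hE, smul_eq_mul]
    ring
  -- The SAC condition concerns smooth fields, so the test vector in `S p` is reduced by linearity
  -- to values of local smooth sections.
  obtain ⟨Z, hZ, hZS⟩ := hS.smooth p
  rw [hZS.self_of_nhds] at hY
  induction hY using Submodule.span_induction with
  | zero => rw [map_zero, map_zero]
  | add a b _ _ ha hb => rw [map_add, map_add, ha, hb, add_zero]
  | smul c a _ ha => rw [map_smul, map_smul, ha, smul_zero]
  | mem Y hY =>
    obtain ⟨i, rfl⟩ := hY
    have hZi := (hZ i).mdifferentiableAt (by simp)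
    have hZiS : ∀ᶠ q in 𝓝 p, Z i q ∈ S q := by
      filter_upwards [hZS] with q hq
      rw [hq]
      exact Submodule.subset_span ⟨i, rfl⟩
    have hN := F.val_shapeN hnabla hf hU hp X hZi hZiS
    -- Here the `λ(X) η(PZ)` of the SAC condition meets the `-λ(X) η(Z)` of `val_shapeN`.
    rw [hSAC.conformal p hp X (Z i) (hZ i), F.screenProj_apply,
      F.lam_of_mem_screen hp hZiS.self_of_nhds, zero_smul, sub_zero,
      F.formB_eq_val_shapeE hnabla hf hU hp (hSAC.xi_tangent p) X hZi hZiS] at hN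
    simp only [map_sub, map_smul, sub_apply, smul_apply, smul_eq_mul, hN]
    ring

end LightlikeFrame

end SemiSymmetric

end HalfLightlike

end LightlikeGeometry

/-! ### From the operator identity to the mean curvatures -/

theorem proposition4p2 {n : ℕ}
    -- the ambient almost contact metric manifold with its semi-symmetric non-metric connection
    {Mbar : Type*} [TopologicalSpace Mbar] [ChartedSpace (EuclideanSpace ℝ (Fin (n + 3))) Mbar]
    [IsManifold (𝓡 (n + 3)) ∞ Mbar]
    (s : LightlikeGeometry.AlmostContactMetricStructure (n + 3) Mbar)
    (nabla : CovariantDerivative (𝓡 (n + 3)) (EuclideanSpace ℝ (Fin (n + 3)))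
      (TangentSpace (𝓡 (n + 3)) : Mbar → Type _))
    (hnabla : LightlikeGeometry.IsSemiSymmetricNonMetric s nabla)
    -- the half-lightlike submanifold with a screen distribution and local sections over `U`
    {M : Type*} [TopologicalSpace M] [ChartedSpace (EuclideanSpace ℝ (Fin (n + 1))) M]
    [IsManifold (𝓡 (n + 1)) ∞ M]
    (f : M → Mbar) (hf : LightlikeGeometry.IsHalfLightlike s.g f)
    (S : ∀ p : M, Submodule ℝ (TangentSpace (𝓡 (n + 1)) p))
    (hS : LightlikeGeometry.IsScreenDistribution s.g f S)
    (U : Set M) (hU : IsOpen U) (F : LightlikeGeometry.LightlikeFrame s.g f S U)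
    (phi : M → ℝ) (hSAC : LightlikeGeometry.LightlikeFrame.IsSAC s F nabla phi)
    (p : M) (hp : p ∈ U)
    -- the principal curvatures of `A*_E` at `p`, in `K = ℝ` or `K = ℂ`
    {K : Type*} [RCLike K] (kappa : Fin (n + 1) → K)
    (hkappa : (Finset.univ : Finset (Fin (n + 1))).val.map kappa =
      LightlikeGeometry.principalCurvatures K (F.shapeE nabla p).toLinearMap)
    (r : ℕ) (hr : 1 ≤ r) :
    LightlikeGeometry.meanCurvature K (F.shapeN nabla p).toLinearMap r =
        (phi p : K) ^ r * LightlikeGeometry.meanCurvature K (F.shapeE nabla p).toLinearMap r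
          + LightlikeGeometry.J kappa r (s.eta (f p) (F.N p)) (phi p) ∧
      ContDiff ℝ ∞ (fun q : ℝ × ℝ ↦ LightlikeGeometry.J kappa r q.1 q.2) := by

  have hm : Module.finrank ℝ (TangentSpace (𝓡 (n + 1)) p) = n + 1 :=
    finrank_euclideanSpace_fin (𝕜 := ℝ)
  have hA : (F.shapeN nabla p).toLinearMap =
      phi p • (F.shapeE nabla p).toLinearMap - s.eta (f p) (F.N p) • LinearMap.id :=
    LinearMap.ext fun X ↦ hSAC.shapeN_eq hnabla hf hS hU hp X
  refine ⟨?_, LightlikeGeometry.contDiff_J kappa r⟩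
  rw [LightlikeGeometry.meanCurvature, LightlikeGeometry.meanCurvature, hA,
    LightlikeGeometry.principalCurvatures_smul_sub_smul _ (hSAC.ne_zero p hp) _ hm kappa hkappa,
    ← hkappa, LightlikeGeometry.esymm_map_mul_sub_eq kappa hr]
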